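/- For a finite abelian group $G$ (written additively), let $\mathsf d(G)$ denote the maximal length $l$ of a zero-sum free sequence $g_1,\dots,g_l$ over $G$, i.e. a sequence (repetitions allowed) with $\sum_{i\in I} g_i\neq 0$ for every nonempty $I\subseteq\{1,\dots,l\}$. For a field $K$, let $K[G]$ be the group algebra with $K$-basis $\{X^g : g\in G\}$ and multiplication $X^gX^h=X^{g+h}$, and let $\mathsf d(G,K)\in\mathbb N_0\cup\{\infty\}$ denote the supremum of all $l\in\mathbb N_0$ for which there is a sequence $g_1,\dots,g_l$ over $G$ such that $$(X^{g_1}-a_1)\cdots(X^{g_l}-a_l)\neq 0\in K[G]\quad\text{for all } a_1,\dots,a_l\in K\setminus\{0\}.$$ A field $K$ is called a splitting field of $G$ if $|\{\zeta\in K : \zeta^{\exp(G)}=1\}|=\exp(G)$, where $\exp(G)$ is the exponent of $G$. **Theorem.** Let $G\cong C_p\oplus C_{pn}$, where $p$ is a prime, $n\geq 1$ is an integer and $C_m$ denotes a cyclic group of order $m$, and let $K$ be a splitting field of $G$. 1. If $p\le 3$, then $\mathsf d(G)=\mathsf d(G,K)$. 2. If $p\ge 5$ and $n\ge 2$, then $\mathsf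 d(G)<\mathsf d(G,K)$. -/

import Mathlib

/-- A sequence `g 0, …, g (l - 1)` over an additive abelian group is zero-sum free if
`∑ i ∈ I, g i ≠ 0` for every nonempty set `I` of indices. -/
def IsZeroSumFree {G : Type*} [AddCommGroup G] {l : ℕ} (g : Fin l → G) : Prop :=
  ∀ I : Finset (Fin l), I.Nonempty → ∑ i ∈ I, g i ≠ 0

/-- `d(G)`: the maximal length of a zero-sum free sequence over `G`, as a supremum in `ℕ ∪ {∞}`
(for finite `G` the lengths are bounded, so that it is a maximum). -/
noncomputable def smallDavenport (G : Type*) [AddCommGroup G] : ℕ∞ :=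
  sSup {m : ℕ∞ | ∃ l : ℕ, m = l ∧ ∃ g : Fin l → G, IsZeroSumFree g}

/-- The element `X ^ g - a` of the group algebra `R[G]`. -/
noncomputable def groupAlgebraFactor {G R : Type*} [AddCommGroup G] [CommRing R]
    (g : G) (a : R) : AddMonoidAlgebra R G :=
  AddMonoidAlgebra.single g 1 - algebraMap R (AddMonoidAlgebra R G) a

/-- `d(G, R)`: the supremum in `ℕ ∪ {∞}` of all `l` for which there is a sequence `g` of length `l`
over `G` such that `∏ i, (X ^ (g i) - a i) ≠ 0` in `R[G]` for all nonzero `a i` in `R`. -/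
noncomputable def algebraDavenport (G R : Type*) [AddCommGroup G] [CommRing R] : ℕ∞ :=
  sSup {m : ℕ∞ | ∃ l : ℕ, m = l ∧ ∃ g : Fin l → G,
    ∀ a : Fin l → R, (∀ i, a i ≠ 0) → ∏ i, groupAlgebraFactor (g i) (a i) ≠ 0}

/-- A field `K` is a splitting field of the finite abelian group `G` if it contains exactly
`exp(G)` roots of unity `ζ` with `ζ ^ exp(G) = 1`. -/
def IsSplittingFieldOfGroup (G K : Type*) [AddCommGroup G] [Field K] : Prop :=
  Nat.card {ζ : K // ζ ^ AddMonoid.exponent G = 1} = AddMonoid.exponent G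

/-! The common value of reference is `d(G) = p + p * n - 2`. The lower bound is an explicit
sequence. The upper bound (Olson) comes from Chevalley–Warning over `𝔽_p`: sufficiently many
elements contain `n` disjoint blocks whose sums lie in the kernel, of order `n`, of the reduction
`C_p ⊕ C_{pn} → C_p ⊕ C_p`, and some of these block sums add up to zero. Moreover `d(G) ≤ d(G, K)`,
since for a zero-sum free sequence the coefficient at `X ^ 0` of the product is `∏ (-a i)`.

For `d(G, K)` the product is evaluated at the characters of `G`. Over a splitting field it is zero
iff every character `χ` satisfies `χ (g i) = a i` for some `i`. The dual group consists of `n`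
cosets of its `p`-torsion, that is, of `n` affine planes over `𝔽_p`, and a suitable `a i` makes the
`i`-th factor vanish on a line of any prescribed plane, with normal vector given by the reduction of
`g i`. The question becomes whether `p * n + p - 1` lines with given directions can be made to cover
`n` planes.

For `p ≤ 3` there are so few directions that this always succeeds (`coversPlanes_two`,
`coversPlanes_three`): `p` parallel lines fill a plane, and if no direction has `p` lines, only a
few small configurations remain.

For `p ≥ 5` and `n ≥ 2` a sequence of length `p * n + p - 1` in four directions fails
(`exists_not_linesCover`). Its multiplicities leave at least two planes without a full parallel
class in the first direction, and no other direction has `p` lines. Covering such a plane is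
expensive, especially with at most one line in the fourth direction (`LinesCover.card_bound`, by
Cauchy–Davenport and the combinatorial Nullstellensatz), and only two lines of that direction exist.
-/

/-! ### Zero-sum subfamilies and Olson's theorem for `C_p ⊕ C_{pn}`. -/

/-- Any `k * (p - 1) + 1` vectors of `𝔽_p ^ k` have a nonempty subfamily with sum zero. -/
theorem exists_sum_eq_zero_of_card_pi {ι : Type*} {p : ℕ} [Fact p.Prime] {k : ℕ} (s : Finset ι)
    (g : ι → Fin k → ZMod p) (hs : k * (p - 1) < s.card) :
    ∃ t ⊆ s, t.Nonempty ∧ ∑ i ∈ t, g i = 0 := by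
  classical
  -- Since `x ^ (p - 1)` is the indicator of `x ≠ 0`, common zeros of the `f j` correspond to
  -- supports with sum zero. By Chevalley–Warning their number is divisible by `p`, so the trivial
  -- zero is not the only one.
  let f : Fin k → MvPolynomial s (ZMod p) := fun j => ∑ i : s, g i j • MvPolynomial.X i ^ (p - 1)
  have hdeg : (∑ j, (f j).totalDegree) < Fintype.card s := by
    refine lt_of_le_of_lt (b := ∑ _j : Fin k, (p - 1)) (Finset.sum_le_sum fun j _ => ?_) ?_
    · refine MvPolynomial.totalDegree_finsetSum_le fun i _ => ?_
      exact (MvPolynomial.totalDegree_smul_le ..).trans (MvPolynomial.totalDegree_X_pow ..).le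
    · simpa using hs
  have hp1 : p - 1 ≠ 0 := by have := (Fact.out : p.Prime).two_le; omega
  let z : {x : s → ZMod p // ∀ j, MvPolynomial.eval x (f j) = 0} :=
    ⟨0, by simp [f, map_sum, hp1]⟩
  have hdvd : p ∣ Nat.card {x : s → ZMod p // ∀ j, MvPolynomial.eval x (f j) = 0} := by
    rw [Nat.card_eq_fintype_card]
    convert! char_dvd_card_solutions_of_fintype_sum_lt p hdeg
  have hnt := Finite.one_lt_card_iff_nontrivial.1 ((Fact.out : p.Prime).one_lt.trans_le <|
    Nat.le_of_dvd (Nat.card_pos_iff.2 ⟨⟨z⟩, inferInstance⟩) hdvd)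
  obtain ⟨x, hx⟩ := exists_ne z
  refine ⟨({a | x.1 a ≠ 0} : Finset _).map ⟨(↑), Subtype.val_injective⟩, ?_, ?_, ?_⟩
  · simp +contextual [Finset.subset_iff]
  · rw [← Subtype.coe_ne_coe, Function.ne_iff] at hx
    obtain ⟨a, ha⟩ := hx
    exact ⟨a, by simpa [z] using ha⟩
  · ext j
    simpa [f, ZMod.pow_card_sub_one, Finset.sum_filter] using x.2 j

theorem exists_sum_eq_zero_of_card_prod {ι : Type*} {p : ℕ} [Fact p.Prime] (s : Finset ι)
    (g : ι → ZMod p × ZMod p) (hs : 2 * (p - 1) < s.card) :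
    ∃ t ⊆ s, t.Nonempty ∧ ∑ i ∈ t, g i = 0 := by
  obtain ⟨t, hts, ht, h⟩ := exists_sum_eq_zero_of_card_pi s (fun i => ![(g i).1, (g i).2]) hs
  refine ⟨t, hts, ht, ?_⟩
  have h0 := congrFun h 0
  have h1 := congrFun h 1
  simp only [Finset.sum_apply, Matrix.cons_val_zero, Matrix.cons_val_one, Pi.zero_apply] at h0 h1
  ext
  · simpa [Prod.fst_sum] using h0
  · simpa [Prod.snd_sum] using h1

/-- Any `3 * p - 2` elements of `C_p ⊕ C_p` have a nonempty subfamily of at most `p` elements with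
sum zero. -/
theorem exists_short_sum_eq_zero {ι : Type*} {p : ℕ} [Fact p.Prime] (s : Finset ι)
    (g : ι → ZMod p × ZMod p) (hs : 3 * p - 2 ≤ s.card) :
    ∃ t ⊆ s, t.Nonempty ∧ t.card ≤ p ∧ ∑ i ∈ t, g i = 0 := by
  classical
  have hp := (Fact.out : p.Prime).two_le
  obtain ⟨s', hs's, hs'⟩ := Finset.exists_subset_card_eq hs
  -- The extra coordinate `1` forces `p ∣ t.card`, so `t.card` is `p` or `2 * p`.
  obtain ⟨t, hts, ht, h⟩ := exists_sum_eq_zero_of_card_pi s'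
    (fun i => ![(g i).1, (g i).2, 1]) (by omega)
  have h0 := congrFun h 0
  have h1 := congrFun h 1
  have h2 := congrFun h 2
  simp only [Finset.sum_apply, Matrix.cons_val_zero, Matrix.cons_val_one, Pi.zero_apply,
    Matrix.cons_val, Finset.sum_const, nsmul_eq_mul, mul_one] at h0 h1 h2
  have hsum : ∑ i ∈ t, g i = 0 := by
    ext
    · simpa [Prod.fst_sum] using h0
    · simpa [Prod.snd_sum] using h1
  have hle := Finset.card_le_card hts
  obtain ⟨c, hc⟩ := (ZMod.natCast_eq_zero_iff _ _).1 h2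
  have htpos := ht.card_pos
  have hc3 : c < 3 := by
    by_contra hc3
    have : p * 3 ≤ p * c := Nat.mul_le_mul_left _ (by omega)
    omega
  -- A zero-sum set of size `2 * p` splits: after deleting one element, the other `2 * p - 1`
  -- contain a zero-sum `u`, and `u` or `t \ u` has at most `p` elements.
  by_cases hc2 : c = 2
  · subst hc2
    obtain ⟨u, hut, hu, hu0⟩ := exists_sum_eq_zero_of_card_prod (t.erase ht.choose) g (by
      rw [Finset.card_erase_of_mem ht.choose_spec]; omega)
    have hut' : u ⊆ t := hut.trans (Finset.erase_subset _ _)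
    have hucard := Finset.card_le_card hut
    rw [Finset.card_erase_of_mem ht.choose_spec] at hucard
    by_cases hup : u.card ≤ p
    · exact ⟨u, hut'.trans (hts.trans hs's), hu, hup, hu0⟩
    · have hcd := Finset.card_sdiff_of_subset hut'
      refine ⟨t \ u, Finset.sdiff_subset.trans (hts.trans hs's), ?_, by omega, ?_⟩
      · rw [← Finset.card_pos]; omega
      · have := Finset.sum_sdiff (f := g) hut'
        rwa [hu0, hsum, add_zero] at this
  · refine ⟨t, hts.trans hs's, ht, ?_, hsum⟩
    rw [hc]
    nlinarith [show c ≤ 1 by omega]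

/-- A family of at least `|A|` elements of a finite abelian group `A` has a nonempty subfamily with
sum zero. -/
theorem exists_sum_eq_zero_of_card_le {ι A : Type*} [AddCommGroup A] [Finite A] (s : Finset ι)
    (g : ι → A) (hs : Nat.card A ≤ s.card) : ∃ t ⊆ s, t.Nonempty ∧ ∑ i ∈ t, g i = 0 := by
  classical
  have := Fintype.ofFinite A
  let e := s.equivFin.symm
  -- Pigeonhole on the `s.card + 1` partial sums: two coincide, and the block between them sums to
  -- zero.
  let P : Fin (s.card + 1) → A := fun j =>
    ∑ i ∈ Finset.univ.filter (fun i : Fin s.card => (i : ℕ) < j), g (e i)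
  obtain ⟨j, k, hjk, hP⟩ : ∃ j k, j < k ∧ P j = P k := by
    obtain ⟨j, k, hne, h⟩ := Fintype.exists_ne_map_eq_of_card_lt P (by
      rw [Fintype.card_fin, ← Nat.card_eq_fintype_card]; omega)
    rcases lt_or_gt_of_ne hne with h' | h'
    exacts [⟨j, k, h', h⟩, ⟨k, j, h', h.symm⟩]
  have hsub : Finset.univ.filter (fun i : Fin s.card => (i : ℕ) < j) ⊆
      Finset.univ.filter (fun i : Fin s.card => (i : ℕ) < k) := by
    intro i
    simp only [Finset.mem_filter, Finset.mem_univ, true_and]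
    intro h
    exact h.trans hjk
  refine ⟨((Finset.univ.filter (fun i : Fin s.card => (i : ℕ) < k)) \
    Finset.univ.filter (fun i : Fin s.card => (i : ℕ) < j)).map
      (e.toEmbedding.trans (Function.Embedding.subtype _)), ?_, ?_, ?_⟩
  · intro x hx
    obtain ⟨i, -, rfl⟩ := Finset.mem_map.1 hx
    exact (e i).2
  · rw [Finset.map_nonempty]
    refine ⟨⟨j, by omega⟩, ?_⟩
    simpa using hjk
  · rw [Finset.sum_map]
    have h := Finset.sum_sdiff (f := fun i => g (e i)) hsub
    change _ + P j = P k at h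
    rw [hP] at h
    simpa using h

/-- A family of `p * (m + 1) - 1` elements of `C_p ⊕ C_p` has `m` disjoint nonempty subfamilies with
sum zero. -/
theorem exists_disjoint_sum_eq_zero {ι : Type*} {p : ℕ} [Fact p.Prime] (m : ℕ) (s : Finset ι)
    (g : ι → ZMod p × ZMod p) (hs : p * (m + 1) - 1 ≤ s.card) :
    ∃ T : Finset (Finset ι), T.card = m ∧ (T : Set (Finset ι)).PairwiseDisjoint id ∧
      ∀ t ∈ T, t ⊆ s ∧ t.Nonempty ∧ ∑ i ∈ t, g i = 0 := by
  classical
  have hp := (Fact.out : p.Prime).two_le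
  induction m generalizing s with
  | zero => exact ⟨∅, by simp⟩
  | succ m ih =>
    -- Blocks are removed greedily. Only the last one may be long, since nothing has to be left
    -- after it; there `2 * p - 1` elements suffice.
    have key : ∃ t ⊆ s, t.Nonempty ∧ (m ≠ 0 → t.card ≤ p) ∧ ∑ i ∈ t, g i = 0 := by
      rcases Nat.eq_zero_or_pos m with rfl | hm
      · obtain ⟨t, h1, h2, h3⟩ := exists_sum_eq_zero_of_card_prod s g (by omega)
        exact ⟨t, h1, h2, fun h => absurd rfl h, h3⟩
      · obtain ⟨t, h1, h2, h3, h4⟩ := exists_short_sum_eq_zero s g (by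
          have : p * 3 ≤ p * (m + 1 + 1) := Nat.mul_le_mul_left _ (by omega)
          omega)
        exact ⟨t, h1, h2, fun _ => h3, h4⟩
    obtain ⟨t, hts, ht, htp, ht0⟩ := key
    obtain ⟨T, hTm, hTd, hT⟩ : ∃ T : Finset (Finset ι), T.card = m ∧
        (T : Set (Finset ι)).PairwiseDisjoint id ∧
        ∀ u ∈ T, u ⊆ s \ t ∧ u.Nonempty ∧ ∑ i ∈ u, g i = 0 := by
      rcases Nat.eq_zero_or_pos m with rfl | hm
      · exact ⟨∅, by simp⟩
      · apply ih
        rw [Finset.card_sdiff_of_subset hts]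
        have := htp hm.ne'
        have : p * (m + 1 + 1) = p * (m + 1) + p := by ring
        omega
    have hdisj : ∀ u ∈ T, Disjoint t u := fun u hu =>
      Finset.disjoint_of_subset_right (hT u hu).1 Finset.disjoint_sdiff
    refine ⟨insert t T, ?_, ?_, ?_⟩
    · rw [Finset.card_insert_of_notMem, hTm]
      intro h
      exact ht.ne_empty (disjoint_self.1 (hdisj t h))
    · rw [Finset.coe_insert, Set.pairwiseDisjoint_insert]
      exact ⟨hTd, fun u hu _ => hdisj u hu⟩
    · intro u hu
      rcases Finset.mem_insert.1 hu with rfl | hu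
      · exact ⟨hts, ht, ht0⟩
      · exact ⟨(hT u hu).1.trans Finset.sdiff_subset, (hT u hu).2⟩

/-- The reduction `C_p ⊕ C_{pn} → C_p ⊕ C_p`. -/
def reduceMod (p n : ℕ) : ZMod p × ZMod (p * n) →+ ZMod p × ZMod p :=
  AddMonoidHom.prodMap (AddMonoidHom.id _) (ZMod.castHom (Dvd.intro n rfl) (ZMod p)).toAddMonoidHom

theorem reduceMod_surjective (p n : ℕ) : Function.Surjective (reduceMod p n) :=
  Function.Surjective.prodMap Function.surjective_id
    (ZMod.ringHom_surjective (ZMod.castHom (Dvd.intro n rfl) (ZMod p)))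

theorem card_ker_reduceMod {p n : ℕ} (hp : p ≠ 0) : Nat.card (reduceMod p n).ker = n := by
  have h := AddSubgroup.card_mul_index (reduceMod p n).ker
  rw [AddSubgroup.index_ker, AddMonoidHom.range_eq_top.2 (reduceMod_surjective p n)] at h
  simp only [Nat.card_prod, Nat.card_zmod, AddSubgroup.card_top] at h
  have hpp : 0 < p * p := by positivity
  exact Nat.eq_of_mul_eq_mul_right hpp (by rw [h]; ring)

/-- Olson's theorem for `C_p ⊕ C_{pn}`: `p * n + p - 1` elements have a nonempty subfamily with sum
zero. -/
theorem exists_sum_eq_zero_of_rank_two {ι : Type*} {p n : ℕ} [Fact p.Prime] (hn : n ≠ 0)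
    (s : Finset ι) (g : ι → ZMod p × ZMod (p * n)) (hs : p * n + p - 1 ≤ s.card) :
    ∃ t ⊆ s, t.Nonempty ∧ ∑ i ∈ t, g i = 0 := by
  classical
  have hp := (Fact.out : p.Prime).ne_zero
  have : NeZero p := ⟨hp⟩
  have : NeZero (p * n) := ⟨mul_ne_zero hp hn⟩
  obtain ⟨T, hTn, hTd, hT⟩ := exists_disjoint_sum_eq_zero n s (fun i => reduceMod p n (g i))
    (by rwa [mul_add, mul_one])
  -- The default `0` is never met on `T`, where all block sums lie in the kernel.
  let h : Finset ι → (reduceMod p n).ker := fun t =>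
    if ht : ∑ i ∈ t, g i ∈ (reduceMod p n).ker then ⟨_, ht⟩ else 0
  have hh : ∀ t ∈ T, (h t : ZMod p × ZMod (p * n)) = ∑ i ∈ t, g i := by
    intro t ht
    have : ∑ i ∈ t, g i ∈ (reduceMod p n).ker := by
      rw [AddMonoidHom.mem_ker, map_sum]
      exact (hT t ht).2.2
    simp only [h, dif_pos this]
  obtain ⟨U, hUT, hU, hU0⟩ := exists_sum_eq_zero_of_card_le T h (by
    rw [card_ker_reduceMod hp, hTn])
  refine ⟨U.biUnion id, ?_, ?_, ?_⟩
  · exact Finset.biUnion_subset.2 fun t ht => (hT t (hUT ht)).1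
  · obtain ⟨t, ht⟩ := hU
    obtain ⟨i, hi⟩ := (hT t (hUT ht)).2.1
    exact ⟨i, Finset.mem_biUnion.2 ⟨t, ht, hi⟩⟩
  · rw [Finset.sum_biUnion (hTd.subset (by exact_mod_cast hUT))]
    have h0 := congrArg (Subtype.val) hU0
    rw [AddSubgroup.val_finsetSum, Finset.sum_congr rfl fun t ht => hh t (hUT ht)] at h0
    simpa using h0

/-! ### Invariance under isomorphism and `d(G) ≤ d(G, K)`. -/

theorem smallDavenport_mono {G H : Type*} [AddCommGroup G] [AddCommGroup H] (e : G ≃+ H) :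
    smallDavenport G ≤ smallDavenport H := by
  refine sSup_le_sSup ?_
  rintro m ⟨l, rfl, g, hg⟩
  refine ⟨l, rfl, fun i => e (g i), fun I hI h => hg I hI ?_⟩
  rwa [← map_sum, e.map_eq_zero_iff] at h

theorem smallDavenport_congr {G H : Type*} [AddCommGroup G] [AddCommGroup H] (e : G ≃+ H) :
    smallDavenport G = smallDavenport H :=
  (smallDavenport_mono e).antisymm (smallDavenport_mono e.symm)

theorem domCongr_groupAlgebraFactor {G H R : Type*} [AddCommGroup G] [AddCommGroup H] [CommRing R]
    (e : G ≃+ H) (g : G) (a : R) :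
    AddMonoidAlgebra.domCongr R R e (groupAlgebraFactor g a) = groupAlgebraFactor (e g) a := by
  rw [groupAlgebraFactor, map_sub, AlgEquiv.commutes, AddMonoidAlgebra.domCongr_single,
    groupAlgebraFactor]

theorem algebraDavenport_mono {G H R : Type*} [AddCommGroup G] [AddCommGroup H] [CommRing R]
    (e : G ≃+ H) : algebraDavenport G R ≤ algebraDavenport H R := by
  refine sSup_le_sSup ?_
  rintro m ⟨l, rfl, g, hg⟩
  refine ⟨l, rfl, fun i => e (g i), fun a ha h => hg a ha ?_⟩
  simp_rw [← domCongr_groupAlgebraFactor e] at h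
  rwa [← map_prod, EmbeddingLike.map_eq_zero_iff] at h

theorem algebraDavenport_congr {G H R : Type*} [AddCommGroup G] [AddCommGroup H] [CommRing R]
    (e : G ≃+ H) : algebraDavenport G R = algebraDavenport H R :=
  (algebraDavenport_mono e).antisymm (algebraDavenport_mono e.symm)

/-- The coefficient of `X ^ 0` in `∏ i, (X ^ (g i) - a i)` for a zero-sum free sequence `g`. -/
theorem coeff_zero_prod_groupAlgebraFactor {G R : Type*} [AddCommGroup G] [CommRing R] {l : ℕ}
    {g : Fin l → G} (hg : IsZeroSumFree g) (a : Fin l → R) :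
    (∏ i, groupAlgebraFactor (g i) (a i)).coeff 0 = ∏ i, -a i := by
  classical
  have hprod : ∀ I : Finset (Fin l), (∏ i ∈ I, AddMonoidAlgebra.single (g i) (1 : R)) =
      AddMonoidAlgebra.single (∑ i ∈ I, g i) 1 := by
    intro I
    induction I using Finset.induction_on with
    | empty => simp [AddMonoidAlgebra.one_def]
    | insert i I hi ih =>
      rw [Finset.prod_insert hi, Finset.sum_insert hi, ih, AddMonoidAlgebra.single_mul_single,
        one_mul]
  have hterm : ∀ I : Finset (Fin l), ((∏ i ∈ I, AddMonoidAlgebra.single (g i) (1 : R)) *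
      ∏ i ∈ Iᶜ, -algebraMap R (AddMonoidAlgebra R G) (a i)) =
      AddMonoidAlgebra.single (∑ i ∈ I, g i) (∏ i ∈ Iᶜ, -a i) := by
    intro I
    simp_rw [← map_neg]
    rw [hprod, ← map_prod, mul_comm, ← Algebra.smul_def, AddMonoidAlgebra.smul_single,
      smul_eq_mul, mul_one]
  simp_rw [groupAlgebraFactor, sub_eq_add_neg]
  rw [Fintype.prod_add, AddMonoidAlgebra.coeff_sum, Finsupp.finsetSum_apply,
    Finset.sum_eq_single ∅]
  · rw [hterm, AddMonoidAlgebra.coeff_single, Finset.sum_empty, Finsupp.single_eq_same,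
      Finset.compl_empty]
  · intro I _ hI
    rw [hterm, AddMonoidAlgebra.coeff_single, Finsupp.single_eq_of_ne]
    exact (hg I (Finset.nonempty_iff_ne_empty.2 hI)).symm
  · simp

/-- The coefficient at `X ^ 0` is `∏ (-a i)`, which is nonzero in a field. -/
theorem smallDavenport_le_algebraDavenport (G K : Type*) [AddCommGroup G] [Field K] :
    smallDavenport G ≤ algebraDavenport G K := by
  refine sSup_le_sSup ?_
  rintro m ⟨l, rfl, g, hg⟩
  refine ⟨l, rfl, g, fun a ha h => ?_⟩
  have h0 := coeff_zero_prod_groupAlgebraFactor hg a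
  rw [h, AddMonoidAlgebra.coeff_zero, Finsupp.zero_apply] at h0
  exact Finset.prod_ne_zero_iff.2 (fun i _ => neg_ne_zero.2 (ha i)) h0.symm

/-! ### Evaluation at characters and roots of unity. -/

theorem lift_prod_groupAlgebraFactor {G K ι : Type*} [AddCommGroup G] [Field K] (s : Finset ι)
    (χ : AddChar G K) (g : ι → G) (a : ι → K) :
    AddMonoidAlgebra.lift K K G χ.toMonoidHom (∏ i ∈ s, groupAlgebraFactor (g i) (a i)) =
      ∏ i ∈ s, (χ (g i) - a i) := by
  rw [map_prod]
  refine Finset.prod_congr rfl fun i _ => ?_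
  rw [groupAlgebraFactor, map_sub, AddMonoidAlgebra.lift_single, AlgHom.commutes, one_smul]
  rfl

/-- An element of the group algebra that vanishes at a separating monoid of characters is zero. -/
theorem eq_zero_of_forall_lift_eq_zero {G K M : Type*} [AddCommGroup G] [Field K] [AddCommMonoid M]
    (B : M → AddChar G K) (h0 : B 0 = 1) (hadd : ∀ m m', B (m + m') = B m * B m')
    (hinj : ∀ g g', (∀ m, B m g = B m g') → g = g') (f : AddMonoidAlgebra K G)
    (hf : ∀ m, AddMonoidAlgebra.lift K K G (B m).toMonoidHom f = 0) : f = 0 := by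
  -- Dedekind's independence of characters with the roles exchanged: each `g` is a homomorphism on
  -- the index monoid `M`, distinct `g` give distinct ones, and the coefficients of `f` form a
  -- linear relation between them.
  let φ : G → (Multiplicative M →* K) := fun g =>
    { toFun := fun m => B m.toAdd g
      map_one' := by simp [h0]
      map_mul' := fun m m' => by simp [hadd] }
  have hφ : Function.Injective φ := fun g g' h =>
    hinj g g' fun m => DFunLike.congr_fun h (Multiplicative.ofAdd m)
  have hli := (linearIndependent_monoidHom (Multiplicative M) K).comp φ hφ
  rw [linearIndependent_iff] at hli
  rw [← AddMonoidAlgebra.coeff_eq_zero]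
  apply hli
  ext m
  have := hf m.toAdd
  rw [AddMonoidAlgebra.lift_apply] at this
  rw [Finsupp.linearCombination_apply, Finsupp.sum_apply']
  exact this

theorem exists_isPrimitiveRoot_of_card {K : Type*} [Field K] {m : ℕ} [NeZero m]
    (h : Nat.card {ζ : K // ζ ^ m = 1} = m) : ∃ ζ : K, IsPrimitiveRoot ζ m := by
  rw [← card_rootsOfUnity_eq_iff_exists_isPrimitiveRoot]
  refine Eq.trans (Nat.card_congr ?_) h
  refine Equiv.ofBijective (fun ζ : rootsOfUnity m K => ⟨(ζ : Kˣ), ?_⟩) ⟨?_, ?_⟩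
  · rw [← Units.val_pow_eq_pow_val, (mem_rootsOfUnity m _).1 ζ.2, Units.val_one]
  · intro a b hab
    exact Subtype.ext (Units.ext (congrArg Subtype.val hab))
  · intro z
    exact ⟨rootsOfUnity.mkOfPowEq z.1 z.2, Subtype.ext (rootsOfUnity.coe_mkOfPowEq z.2)⟩

theorem exponent_zmod_prod (p n : ℕ) : AddMonoid.exponent (ZMod p × ZMod (p * n)) = p * n := by
  rw [AddMonoid.exponent_prod, ZMod.exponent, ZMod.exponent]
  exact Nat.lcm_eq_right (Dvd.intro n rfl)

/-! ### The extremal zero-sum free sequence. -/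

/-- `(1, 0)` repeated `p - 1` times followed by `(0, 1)` repeated `m - 1` times. -/
theorem le_smallDavenport_prod {p m : ℕ} (hp : 0 < p) (hm : 0 < m) :
    ((p + m - 2 : ℕ) : ℕ∞) ≤ smallDavenport (ZMod p × ZMod m) := by
  classical
  refine le_sSup ⟨p + m - 2, rfl, fun i => if (i : ℕ) < p - 1 then (1, 0) else (0, 1), ?_⟩
  intro I hI h0
  have hcast : ∀ (k c : ℕ), c < k → (c : ZMod k) = 0 → c = 0 := fun k c hck hc =>
    Nat.eq_zero_of_dvd_of_lt ((ZMod.natCast_eq_zero_iff c k).1 hc) hck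
  have h1 := congrArg Prod.fst h0
  have h2 := congrArg Prod.snd h0
  rw [Prod.fst_sum] at h1
  rw [Prod.snd_sum] at h2
  simp only [apply_ite Prod.fst, apply_ite Prod.snd, Prod.fst_zero, Prod.snd_zero] at h1 h2
  rw [Finset.sum_boole] at h1
  have h2' : (((I.filter fun i : Fin _ => ¬ (i : ℕ) < p - 1).card : ℕ) : ZMod m) = 0 := by
    refine Eq.trans ?_ h2
    rw [← Finset.sum_boole]
    exact Finset.sum_congr rfl fun i _ => by split_ifs <;> rfl
  have hc1 : (I.filter fun i : Fin _ => (i : ℕ) < p - 1).card ≤ (Finset.range (p - 1)).card :=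
    Finset.card_le_card_of_injOn (fun i => (i : ℕ)) (fun i hi => by simp_all)
      Fin.val_injective.injOn
  have hc2 : (I.filter fun i : Fin _ => ¬ (i : ℕ) < p - 1).card ≤ (Finset.range (m - 1)).card := by
    refine Finset.card_le_card_of_injOn (fun i => (i : ℕ) - (p - 1)) (fun i hi => ?_)
      (fun i hi j hj h => Fin.ext ?_)
    · have := i.2
      simp at hi ⊢
      omega
    · simp at hi hj h
      omega
  rw [Finset.card_range] at hc1 hc2
  have e1 := hcast p _ (by omega) h1
  have e2 := hcast m _ (by omega) h2'
  have := Finset.card_filter_add_card_filter_not (s := I) (fun i => (i : ℕ) < p - 1)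
  have := hI.card_pos
  omega

/-! ### Lower bounds for covering one affine plane by lines in four directions. -/

open MvPolynomial in
/-- The part of top degree of a product of affine linear forms is the product of their linear
parts. -/
theorem coeff_prod_sub_C {σ ι R : Type*} [CommRing R] (s : Finset ι)
    (L : ι → MvPolynomial σ R) (hL : ∀ i, (L i).IsHomogeneous 1) (c : ι → R) (t : σ →₀ ℕ)
    (ht : s.card ≤ t.degree) :
    (∏ i ∈ s, (L i - C (c i))).coeff t = (∏ i ∈ s, L i).coeff t := by
  classical
  have hdeg : ∀ u : Finset ι, (∏ i ∈ u, (L i - C (c i))).totalDegree ≤ u.card := by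
    intro u
    refine (totalDegree_finsetProd _ _).trans ?_
    rw [Finset.card_eq_sum_ones]
    refine Finset.sum_le_sum fun i _ => (totalDegree_sub_C_le _ _).trans (hL i).totalDegree_le
  have key : ∀ u : Finset ι, ∀ m ∈ (∏ i ∈ u, (L i - C (c i)) - ∏ i ∈ u, L i).support,
      m.degree < u.card := by
    intro u
    induction u using Finset.induction_on with
    | empty => simp
    | insert a u ha ih =>
      intro m hm
      rw [Finset.prod_insert ha, Finset.prod_insert ha, show
        (L a - C (c a)) * ∏ i ∈ u, (L i - C (c i)) - L a * ∏ i ∈ u, L i =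
        L a * (∏ i ∈ u, (L i - C (c i)) - ∏ i ∈ u, L i) - C (c a) * ∏ i ∈ u, (L i - C (c i))
        by ring] at hm
      rw [Finset.card_insert_of_notMem ha]
      rcases Finset.mem_union.1 (support_sub σ _ _ hm) with h | h
      · obtain ⟨x, hx, y, hy, rfl⟩ := Finset.mem_add.1 (support_mul _ _ h)
        have h1 := ih y hy
        have h2 : x.degree = 1 := by
          rw [Finsupp.degree_eq_weight_one]
          exact hL a (mem_support_iff.1 hx)
        rw [map_add, h2]
        omega
      · have h3 := le_totalDegree h
        have h4 := (totalDegree_mul (C (c a)) (∏ i ∈ u, (L i - C (c i)))).trans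
          (by rw [totalDegree_C, zero_add])
        have := hdeg u
        change m.degree ≤ _ at h3
        omega
  rw [← sub_eq_zero, ← coeff_sub]
  by_contra h
  have := key s t (mem_support_iff.2 h)
  omega

open MvPolynomial in
/-- The coefficients of a binary form are those of its dehomogenization. -/
theorem coeff_dehomogenize {R : Type*} [CommRing R] {N : ℕ} (P : MvPolynomial (Fin 2) R)
    (hP : P.IsHomogeneous N) (t : Fin 2 →₀ ℕ) (ht : t.degree = N) :
    (aeval ![Polynomial.X, (1 : Polynomial R)] P).coeff (t 0) = P.coeff t := by
  classical
  have hterm : ∀ m : Fin 2 →₀ ℕ, (aeval ![Polynomial.X, (1 : Polynomial R)]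
      (monomial m (P.coeff m))).coeff (t 0) = if t 0 = m 0 then P.coeff m else 0 := by
    intro m
    rw [aeval_monomial, Finsupp.prod_fintype _ _ (by simp)]
    simp [Fin.prod_univ_two, Polynomial.coeff_X_pow]
  conv_lhs => rw [P.as_sum, map_sum, Polynomial.finsetSum_coeff]
  rw [Finset.sum_congr rfl fun m _ => hterm m, Finset.sum_eq_single t]
  · simp
  · intro m hm hmt
    rw [if_neg]
    intro h0
    apply hmt
    have hd : m.degree = N := by
      rw [Finsupp.degree_eq_weight_one]
      exact hP (mem_support_iff.1 hm)
    rw [Finsupp.degree_eq_sum, Fin.sum_univ_two] at hd ht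
    ext i
    fin_cases i
    · exact h0.symm
    · simp only [Fin.mk_one]; omega
  · intro h
    simpa using h

theorem ZMod.natCast_ne_zero_of_lt {p c : ℕ} (h0 : 0 < c) (h : c < p) : (c : ZMod p) ≠ 0 := by
  rw [Ne, ZMod.natCast_eq_zero_iff]
  exact Nat.not_dvd_of_pos_of_lt h0 h

theorem ZMod.choose_ne_zero {p c k : ℕ} [Fact p.Prime] (hc : c < p) (hk : k ≤ c) :
    (c.choose k : ZMod p) ≠ 0 := by
  rw [Ne, ZMod.natCast_eq_zero_iff]
  intro h
  have h1 : p ∣ c.factorial := by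
    rw [← Nat.choose_mul_factorial_mul_factorial hk, mul_assoc]
    exact h.mul_right _
  exact absurd (((Fact.out : p.Prime).dvd_factorial).1 h1) (by omega)

/-- Among two consecutive inner coefficients of `(X + 1) ^ c * (3 * X - 1)` modulo `p`, one is
nonzero. -/
theorem three_mul_choose_ne {p c l : ℕ} [Fact p.Prime] (hp : 5 ≤ p) (hc : c < p) (hl : l < c)
    (h1 : 3 * (c.choose l : ZMod p) = c.choose (l + 1)) :
    3 * (c.choose (l + 1) : ZMod p) ≠ c.choose (l + 2) := by
  intro h2
  have hu := ZMod.choose_ne_zero hc hl.le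
  have h3 : (3 : ZMod p) ≠ 0 := by
    exact_mod_cast ZMod.natCast_ne_zero_of_lt (c := 3) (by omega) (by omega)
  have h4 : (4 : ZMod p) ≠ 0 := by
    exact_mod_cast ZMod.natCast_ne_zero_of_lt (c := 4) (by omega) (by omega)
  have e1 := congrArg (Nat.cast (R := ZMod p)) (Nat.choose_succ_right_eq c l)
  have e2 := congrArg (Nat.cast (R := ZMod p)) (Nat.choose_succ_right_eq c (l + 1))
  rw [Nat.cast_mul, Nat.cast_mul, Nat.cast_sub hl.le] at e1
  rw [Nat.cast_mul, Nat.cast_mul, Nat.cast_sub (by omega : l + 1 ≤ c)] at e2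
  push_cast at e1 e2
  rw [add_assoc, one_add_one_eq_two] at e2
  rw [← h2, ← h1] at e2
  rw [← h1] at e1
  -- The first ratio gives `c = 4 * l + 3`; the second would give `c = 4 * l + 7`, so `4 = 0` up to
  -- factors invertible modulo `p`.
  have f1 : (c : ZMod p) = 4 * l + 3 := by
    have : (c.choose l : ZMod p) * (c - (4 * l + 3)) = 0 := by linear_combination -e1
    rcases mul_eq_zero.1 this with h | h
    · exact absurd h hu
    · linear_combination h
  have : (c.choose l : ZMod p) * (3 * 4) = 0 := by
    rw [f1] at e2
    linear_combination e2
  simp [hu, h3, h4] at this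

open Polynomial in
theorem coeff_X_add_one_pow_mul (R : Type*) [CommRing R] (c k : ℕ) :
    ((X + 1 : R[X]) ^ c * (3 * X - 1)).coeff k =
      (if k = 0 then 0 else 3 * (c.choose (k - 1) : R)) - c.choose k := by
  rw [mul_sub, mul_one, coeff_sub, coeff_X_add_one_pow, ← mul_assoc]
  cases k with
  | zero => simp
  | succ k =>
    rw [coeff_mul_X, mul_comm, show (3 : R[X]) = C 3 by rfl, coeff_C_mul, coeff_X_add_one_pow]
    simp

/-- Polynomial method: fewer than `2 * p - 2` lines in four directions, without a full parallel
class and with a single line in the fourth direction, do not cover the affine plane. -/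
theorem exists_not_mem_lines_of_singleton {p : ℕ} [Fact p.Prime] (hp : 5 ≤ p)
    (A B C : Finset (ZMod p)) (d : ZMod p) (hA : A.card < p) (hB : B.card < p) (hC : C.card < p)
    (h : A.card + B.card + C.card + 1 ≤ 2 * p - 3) :
    ∃ x y, x ∉ A ∧ y ∉ B ∧ x + y ∉ C ∧ 3 * x - y ≠ d := by
  classical
  set a := A.card
  set b := B.card
  set c := C.card
  -- Sought is a nonzero coefficient of `x ^ i * y ^ (a + b + c + 1 - i)` in `x ^ a * y ^ b * (x +
  -- y) ^ c * (3 * x - y)` with both exponents below `p`. If `a` or `b` is `p - 1`, an end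
  -- coefficient `-1` or `3` serves; otherwise two consecutive `i` are admissible, and their
  -- coefficients do not both vanish.
  obtain ⟨i, hai, hip, hi1, hi2, hne⟩ : ∃ i, a ≤ i ∧ i < p ∧ i ≤ a + c + 1 ∧ a + b + c + 1 < p + i ∧
      (if i - a = 0 then 0 else 3 * (c.choose (i - a - 1) : ZMod p)) - c.choose (i - a) ≠ 0 := by
    by_cases ha : a = p - 1
    · exact ⟨a, le_rfl, hA, by omega, by omega, by simp⟩
    by_cases hb : b = p - 1
    · refine ⟨a + c + 1, by omega, by omega, le_rfl, by omega, ?_⟩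
      have : a + c + 1 - a = c + 1 := by omega
      rw [this]
      simpa using ZMod.natCast_ne_zero_of_lt (p := p) (c := 3) (by omega) (by omega)
    obtain ⟨k, hk1, hk2, hk3, hk4⟩ : ∃ k, k ≤ c ∧ a + k + 1 < p ∧ a + b + c + 1 < p + (a + k) ∧
        a + k + 1 ≤ a + c + 1 :=
      -- The smallest admissible `i`, shifted by `a`.
      ⟨max a (a + b + c + 2 - p) - a, by omega, by omega, by omega, by omega⟩
    by_contra! hcon
    have e0 := hcon (a + k) (by omega) (by omega) (by omega) (by omega)
    have e1 := hcon (a + k + 1) (by omega) (by omega) (by omega) (by omega)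
    rw [show a + k - a = k by omega] at e0
    rw [show a + k + 1 - a = k + 1 by omega] at e1
    cases k with
    | zero => simp at e0
    | succ l =>
      simp only [Nat.add_eq_zero_iff, one_ne_zero, and_false, if_false, Nat.add_sub_cancel,
        sub_eq_zero] at e0 e1
      exact three_mul_choose_ne hp hC (by omega) e0 e1
  let L : (A ⊕ B) ⊕ (C ⊕ Unit) → MvPolynomial (Fin 2) (ZMod p) :=
    Sum.elim (Sum.elim (fun _ => .X 0) (fun _ => .X 1))
      (Sum.elim (fun _ => .X 0 + .X 1) (fun _ => .C 3 * .X 0 - .X 1))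
  let v : (A ⊕ B) ⊕ (C ⊕ Unit) → ZMod p :=
    Sum.elim (Sum.elim (fun z => z) (fun z => z)) (Sum.elim (fun z => z) (fun _ => d))
  have hX : ∀ i, (MvPolynomial.X i : MvPolynomial (Fin 2) (ZMod p)).IsHomogeneous 1 :=
    fun i => MvPolynomial.isHomogeneous_X _ i
  have hL : ∀ i, (L i).IsHomogeneous 1 := by
    rintro ((i | i) | (i | i))
    · exact hX 0
    · exact hX 1
    · exact (hX 0).add (hX 1)
    · exact ((MvPolynomial.isHomogeneous_C_mul_X 3 0)).sub (hX 1)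
  let f := ∏ i, (L i - MvPolynomial.C (v i))
  let t : Fin 2 →₀ ℕ := Finsupp.equivFunOnFinite.symm ![i, a + b + c + 1 - i]
  have ht : t.degree = a + b + c + 1 := by
    rw [Finsupp.degree_eq_sum, Fin.sum_univ_two]
    simp [t]
    omega
  have hcard : (Finset.univ : Finset ((A ⊕ B) ⊕ (C ⊕ Unit))).card = a + b + c + 1 := by
    simp [a, b, c, add_assoc]
  have hhom : (∏ i, L i).IsHomogeneous (a + b + c + 1) := by
    have := MvPolynomial.IsHomogeneous.prod Finset.univ L (fun _ => 1) fun i _ => hL i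
    rwa [← Finset.card_eq_sum_ones, hcard] at this
  have hcoeff : f.coeff t ≠ 0 := by
    rw [coeff_prod_sub_C _ L hL v t (by rw [hcard, ht]), ← coeff_dehomogenize _ hhom t ht, map_prod]
    have : ∏ i, MvPolynomial.aeval ![Polynomial.X, (1 : Polynomial (ZMod p))] (L i) =
        (Polynomial.X + 1 : Polynomial (ZMod p)) ^ c * (3 * Polynomial.X - 1) *
          Polynomial.X ^ a := by
      have h3 : (3 : Polynomial (ZMod p)) = Polynomial.C 3 := rfl
      simp [L, Fintype.prod_sum_type, a, c]
      rw [← h3]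
      ring
    rw [this, show t 0 = i by simp [t], Polynomial.coeff_mul_X_pow', if_pos hai,
      coeff_X_add_one_pow_mul]
    exact hne
  have hdeg : f.totalDegree = t.degree := by
    refine le_antisymm ?_ (MvPolynomial.le_totalDegree (MvPolynomial.mem_support_iff.2 hcoeff))
    rw [ht, ← hcard, Finset.card_eq_sum_ones]
    exact (MvPolynomial.totalDegree_finsetProd _ _).trans (Finset.sum_le_sum fun i _ =>
      (MvPolynomial.totalDegree_sub_C_le _ _).trans (hL i).totalDegree_le)
  obtain ⟨s, -, hs⟩ := MvPolynomial.combinatorial_nullstellensatz_exists_eval_nonzero f t hcoeff hdeg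
    (fun _ => Finset.univ) (by
      intro j
      rw [Finset.card_univ, ZMod.card]
      fin_cases j
      · simpa [t] using hip
      · simp [t]; omega)
  rw [map_prod, Finset.prod_ne_zero_iff] at hs
  refine ⟨s 0, s 1, fun hx => ?_, fun hy => ?_, fun hz => ?_, fun hd => ?_⟩
  · exact hs (.inl (.inl ⟨_, hx⟩)) (Finset.mem_univ _) (by simp [L, v])
  · exact hs (.inl (.inr ⟨_, hy⟩)) (Finset.mem_univ _) (by simp [L, v])
  · exact hs (.inr (.inl ⟨_, hz⟩)) (Finset.mem_univ _) (by simp [L, v])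
  · exact hs (.inr (.inr ())) (Finset.mem_univ _) (by simp [L, v, hd])

open scoped Pointwise in
/-- At most `2 * p - 2` lines in three directions, without a full parallel class, do not cover the
affine plane. -/
theorem exists_not_mem_lines_of_empty {p : ℕ} [Fact p.Prime]
    (A B C : Finset (ZMod p)) (hA : A.card < p) (hB : B.card < p) (hC : C.card < p)
    (h : A.card + B.card + C.card ≤ 2 * p - 2) : ∃ x y, x ∉ A ∧ y ∉ B ∧ x + y ∉ C := by
  classical
  have hcA : (Aᶜ).card = p - A.card := by rw [Finset.card_compl, ZMod.card]
  have hcB : (Bᶜ).card = p - B.card := by rw [Finset.card_compl, ZMod.card]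
  -- By Cauchy–Davenport the sums `x + y` with `x ∉ A`, `y ∉ B` take more than `C.card` values.
  have hcd := ZMod.cauchy_davenport (Fact.out : p.Prime) (s := Aᶜ) (t := Bᶜ)
    (Finset.card_pos.1 (by omega)) (Finset.card_pos.1 (by omega))
  obtain ⟨z, hz, hzC⟩ := Finset.exists_mem_notMem_of_card_lt_card (s := C) (t := Aᶜ + Bᶜ)
    (lt_of_lt_of_le (by omega) hcd)
  obtain ⟨x, hx, y, hy, rfl⟩ := Finset.mem_add.1 hz
  exact ⟨x, y, Finset.mem_compl.1 hx, Finset.mem_compl.1 hy, hzC⟩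

/-- At most `p` lines in four directions, without a full parallel class but with some line in the
fourth direction, do not cover the affine plane. -/
theorem exists_not_mem_lines_of_nonempty {p : ℕ} [Fact p.Prime] (hp : 5 ≤ p)
    (A B C D : Finset (ZMod p)) (hD0 : D.Nonempty) (hD : D.card < p)
    (h : A.card + B.card + C.card + D.card ≤ p) :
    ∃ x y, x ∉ A ∧ y ∉ B ∧ x + y ∉ C ∧ 3 * x - y ∉ D := by
  classical
  have h3 : (3 : ZMod p) ≠ 0 := by
    exact_mod_cast ZMod.natCast_ne_zero_of_lt (p := p) (c := 3) (by omega) (by omega)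
  have h4 : (4 : ZMod p) ≠ 0 := by
    exact_mod_cast ZMod.natCast_ne_zero_of_lt (p := p) (c := 4) (by omega) (by omega)
  have hex : ∀ S : Finset (ZMod p), S.card < p → ∃ z, z ∉ S := by
    intro S hS
    by_contra! hcon
    rw [Finset.eq_univ_of_forall hcon, Finset.card_univ, ZMod.card] at hS
    exact lt_irrefl _ hS
  -- The search is confined to the line `3 * x - y = e`, which misses `D`. Each line of the other
  -- three directions meets it in one point (here `3` and `4` must be invertible), and there are at
  -- most `p - 1` of them since `D` is nonempty.
  obtain ⟨e, he⟩ := hex D hD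
  obtain ⟨x, hx⟩ := hex (A ∪ B.image (fun y => (y + e) / 3) ∪ C.image (fun z => (z + e) / 4)) (by
    have h1 := Finset.card_union_le (A ∪ B.image (fun y => (y + e) / 3))
      (C.image (fun z => (z + e) / 4))
    have h2 := Finset.card_union_le A (B.image (fun y => (y + e) / 3))
    have h3 := Finset.card_image_le (s := B) (f := fun y => (y + e) / 3)
    have h4 := Finset.card_image_le (s := C) (f := fun z => (z + e) / 4)
    have := hD0.card_pos
    omega)
  simp only [Finset.mem_union, Finset.mem_image, not_or, not_exists, not_and] at hx
  obtain ⟨⟨hxA, hxB⟩, hxC⟩ := hx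
  refine ⟨x, 3 * x - e, hxA, fun hy => hxB _ hy ?_, fun hz => hxC _ hz ?_, ?_⟩
  · field_simp
    ring
  · field_simp
    ring
  · rwa [sub_sub_cancel]

/-! ### Four directions do not cover `n` planes when `p ≥ 5`. -/

/-- The lines `x ∈ A`, `y ∈ B`, `x + y ∈ C`, `3 * x - y ∈ D` cover the affine plane over `𝔽_p`. -/
def LinesCover {p : ℕ} (A B C D : Finset (ZMod p)) : Prop :=
  ∀ x y : ZMod p, x ∈ A ∨ y ∈ B ∨ x + y ∈ C ∨ 3 * x - y ∈ D

/-- Lines of the fourth direction are what makes a cover cheap: with two of them the bound is only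
`p + 1`, whereas zero or one force roughly `2 * p` lines in all. -/
theorem LinesCover.card_bound {p : ℕ} [Fact p.Prime] (hp : 5 ≤ p) {A B C D : Finset (ZMod p)}
    (h : LinesCover A B C D) (hA : A.card < p) (hB : B.card < p) (hC : C.card < p)
    (hD : D.card ≤ 2) :
    p + 1 ≤ A.card + B.card + C.card + D.card ∧
      (D.card = 0 → 2 * p - 1 ≤ A.card + B.card + C.card) ∧
      (D.card = 1 → 2 * p - 3 ≤ A.card + B.card + C.card) := by
  have h0 : D.card = 0 → 2 * p - 1 ≤ A.card + B.card + C.card := by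
    intro hD0
    by_contra hlt
    rw [Finset.card_eq_zero] at hD0
    obtain ⟨x, y, hx, hy, hz⟩ := exists_not_mem_lines_of_empty A B C hA hB hC (by omega)
    simpa [hx, hy, hz, hD0] using h x y
  have h1 : D.card = 1 → 2 * p - 3 ≤ A.card + B.card + C.card := by
    intro hD1
    by_contra hlt
    obtain ⟨d, rfl⟩ := Finset.card_eq_one.1 hD1
    obtain ⟨x, y, hx, hy, hz, hd⟩ :=
      exists_not_mem_lines_of_singleton hp A B C d hA hB hC (by omega)
    simpa [hx, hy, hz, hd] using h x y
  refine ⟨?_, h0, h1⟩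
  by_cases hD2 : D.card = 2
  · by_contra hlt
    obtain ⟨x, y, hx, hy, hz, hd⟩ := exists_not_mem_lines_of_nonempty hp A B C D
      (Finset.card_pos.1 (by omega)) (by omega) (by omega)
    simpa [hx, hy, hz, hd] using h x y
  · omega

/-- `p * n + p - 1` lines in four directions, distributed as below, do not cover `n` planes. -/
theorem exists_not_linesCover {p n : ℕ} [Fact p.Prime] (hp : 5 ≤ p) (hn : 2 ≤ n)
    (A B C D : ℕ → Finset (ZMod p))
    (hA : ∑ τ ∈ Finset.range n, (A τ).card ≤ p * (n - 1) - 1)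
    (hB : ∑ τ ∈ Finset.range n, (B τ).card ≤ p - 1)
    (hC : ∑ τ ∈ Finset.range n, (C τ).card ≤ p - 1)
    (hD : ∑ τ ∈ Finset.range n, (D τ).card ≤ 2) :
    ∃ τ < n, ¬ LinesCover (A τ) (B τ) (C τ) (D τ) := by
  classical
  by_contra! hcov
  have hle : ∀ (F : ℕ → Finset (ZMod p)) (k : ℕ), ∑ τ ∈ Finset.range n, (F τ).card ≤ k →
      ∀ τ < n, (F τ).card ≤ k := fun F k hF τ hτ =>
    (Finset.single_le_sum (f := fun τ => (F τ).card) (fun _ _ => Nat.zero_le _)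
      (Finset.mem_range.2 hτ)).trans hF
  have hBp := hle B _ hB
  have hCp := hle C _ hC
  have hDp := hle D _ hD
  obtain ⟨m, rfl⟩ : ∃ m, n = m + 2 := ⟨n - 2, by omega⟩
  have hpm : p * (m + 2 - 1) = p * m + p := by
    rw [show m + 2 - 1 = m + 1 by omega]; ring
  let S := (Finset.range (m + 2)).filter fun τ => (A τ).card < p
  -- Otherwise `n - 1` planes would each use `p` lines of the first direction, one more than
  -- available.
  have hS : 1 < S.card := by
    by_contra hS
    have h1 := Finset.card_filter_add_card_filter_not (s := Finset.range (m + 2))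
      (fun τ => (A τ).card < p)
    rw [Finset.card_range] at h1
    change S.card + _ = _ at h1
    have h2 : ((Finset.range (m + 2)).filter fun τ => ¬ (A τ).card < p).card • p ≤
        ∑ τ ∈ (Finset.range (m + 2)).filter fun τ => ¬ (A τ).card < p, (A τ).card :=
      Finset.card_nsmul_le_sum _ _ _ fun τ hτ => by simpa using (Finset.mem_filter.1 hτ).2
    have h3 := Finset.sum_le_sum_of_subset (f := fun τ => (A τ).card)
      (Finset.filter_subset (fun τ => ¬ (A τ).card < p) (Finset.range (m + 2)))
    have h4 : (m + 1) * p ≤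
        ((Finset.range (m + 2)).filter fun τ => ¬ (A τ).card < p).card * p :=
      Nat.mul_le_mul_right _ (by omega)
    rw [smul_eq_mul] at h2
    have : (m + 1) * p = p * m + p := by ring
    omega
  obtain ⟨σ, hσ, τ, hτ, hne⟩ := Finset.one_lt_card.1 hS
  obtain ⟨hσn, hσA⟩ := Finset.mem_filter.1 hσ
  obtain ⟨hτn, hτA⟩ := Finset.mem_filter.1 hτ
  have hbound : ∀ υ < m + 2, (A υ).card < p → _ := fun υ hυ hυA =>
    (hcov υ hυ).card_bound hp hυA (by have := hBp υ hυ; omega) (by have := hCp υ hυ; omega)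
      (hDp υ hυ)
  have bσ := hbound σ (Finset.mem_range.1 hσn) hσA
  have bτ := hbound τ (Finset.mem_range.1 hτn) hτA
  let N : ℕ → ℕ := fun υ => (A υ).card + (B υ).card + (C υ).card + (D υ).card
  have hN : ∀ υ ∈ Finset.range (m + 2), p ≤ N υ := by
    intro υ hυ
    by_cases hυA : (A υ).card < p
    · have := (hbound υ (Finset.mem_range.1 hυ) hυA).1
      simp only [N]; omega
    · simp only [N]; omega
  have hsum : ∑ υ ∈ Finset.range (m + 2), N υ ≤ p * m + p - 1 + (p - 1) + (p - 1) + 2 := by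
    simp only [N, Finset.sum_add_distrib]
    omega
  have hpair : ({σ, τ} : Finset ℕ) ⊆ Finset.range (m + 2) := by
    intro υ hυ
    rcases Finset.mem_insert.1 hυ with rfl | hυ
    · exact hσn
    · rwa [Finset.mem_singleton.1 hυ]
  have hrest : m * p ≤ ∑ υ ∈ Finset.range (m + 2) \ {σ, τ}, N υ := by
    have := Finset.card_nsmul_le_sum (Finset.range (m + 2) \ {σ, τ}) N p
      fun υ hυ => hN υ (Finset.mem_sdiff.1 hυ).1
    rwa [Finset.card_sdiff_of_subset hpair, Finset.card_pair hne, Finset.card_range,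
      Nat.add_sub_cancel, smul_eq_mul] at this
  have hsplit := Finset.sum_sdiff (f := N) hpair
  rw [Finset.sum_pair hne] at hsplit
  have hDpair := (Finset.sum_le_sum_of_subset (f := fun υ => (D υ).card) hpair).trans hD
  rw [Finset.sum_pair hne] at hDpair
  have : m * p = p * m := mul_comm _ _
  simp only [N] at hsplit hrest hsum
  -- The other `m` planes use at least `m * p` lines, leaving at most `3 * p - 1` for `σ` and `τ`.
  -- These share at most two lines of the fourth direction: a split `2 + 0` costs at least `(p + 1)
  -- + (2 * p - 1) = 3 * p`, a split `1 + 1` at least `2 * (2 * p - 2)`, and fewer such lines cost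
  -- even more.
  omega

/-! ### Covering `n` planes when `p` is 2 or 3. -/

/-- The families of lines `{v | v · r i = c i}`, `i ∈ s`, with normal vectors `r i`, can be
distributed over `n` affine planes over `𝔽_p` and the `c i` chosen such that all planes are
covered. -/
def CoversPlanes {ι : Type*} {p : ℕ} (r : ι → ZMod p × ZMod p) (s : Finset ι) (n : ℕ) : Prop :=
  ∃ (T : ι → ℕ) (c : ι → ZMod p), ∀ τ < n, ∀ x y, ∃ i ∈ s,
    T i = τ ∧ x * (r i).1 + y * (r i).2 = c i

theorem CoversPlanes.zero {ι : Type*} {p : ℕ} (r : ι → ZMod p × ZMod p) (s : Finset ι) :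
    CoversPlanes r s 0 :=
  ⟨fun _ => 0, fun _ => 0, fun τ hτ => absurd hτ (Nat.not_lt_zero τ)⟩

theorem coversPlanes_one {ι : Type*} {p : ℕ} {r : ι → ZMod p × ZMod p} {s : Finset ι}
    (c : ι → ZMod p) (h : ∀ x y, ∃ i ∈ s, x * (r i).1 + y * (r i).2 = c i) :
    CoversPlanes r s 1 :=
  ⟨fun _ => 0, c, fun τ hτ x y => by
    obtain ⟨i, hi, h⟩ := h x y
    exact ⟨i, hi, (Nat.lt_one_iff.1 hτ).symm, h⟩⟩

/-- The induction step of all covering arguments: `t` is spent on the plane with index `n`, the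
remaining lines on the earlier ones. -/
theorem CoversPlanes.succ {ι : Type*} [DecidableEq ι] {p n : ℕ} {r : ι → ZMod p × ZMod p}
    {s t : Finset ι} (hts : t ⊆ s) (ht : CoversPlanes r t 1) (hs : CoversPlanes r (s \ t) n) :
    CoversPlanes r s (n + 1) := by
  obtain ⟨T₁, c₁, h₁⟩ := ht
  obtain ⟨T, c, h⟩ := hs
  refine ⟨fun i => if i ∈ t then n else T i, fun i => if i ∈ t then c₁ i else c i, ?_⟩
  intro τ hτ x y
  rcases Nat.lt_succ_iff_lt_or_eq.1 hτ with hτ | rfl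
  · obtain ⟨i, hi, h1, h2⟩ := h τ hτ x y
    obtain ⟨his, hit⟩ := Finset.mem_sdiff.1 hi
    exact ⟨i, his, by simp [hit, h1], by simp [hit, h2]⟩
  · obtain ⟨i, hi, h1, h2⟩ := h₁ 0 one_pos x y
    exact ⟨i, hts hi, by simp [hi], by simp [hi, h2]⟩

theorem coversPlanes_one_of_parallel {ι : Type*} {p : ℕ} [NeZero p] {r : ι → ZMod p × ZMod p}
    {s : Finset ι} {d : ZMod p × ZMod p} (hr : ∀ i ∈ s, r i = d) (hs : s.card = p) :
    CoversPlanes r s 1 := by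
  classical
  have e : s ≃ ZMod p := Fintype.equivOfCardEq (by rw [Fintype.card_coe, hs, ZMod.card])
  refine coversPlanes_one (fun i => if hi : i ∈ s then e ⟨i, hi⟩ else 0) fun x y => ?_
  refine ⟨e.symm (x * d.1 + y * d.2), Subtype.prop _, ?_⟩
  rw [hr _ (Subtype.prop _)]
  simp

/-- All lines are put through the origin, and every point lies on such a line. -/
theorem coversPlanes_one_of_concurrent {ι : Type*} {p : ℕ} {r : ι → ZMod p × ZMod p}
    {s : Finset ι} {D : Finset (ZMod p × ZMod p)}
    (hD : ∀ x y : ZMod p, ∃ d ∈ D, x * d.1 + y * d.2 = 0) (hr : ∀ d ∈ D, ∃ i ∈ s, r i = d) :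
    CoversPlanes r s 1 := by
  refine coversPlanes_one (fun _ => 0) fun x y => ?_
  obtain ⟨d, hd, h⟩ := hD x y
  obtain ⟨i, hi, rfl⟩ := hr d hd
  exact ⟨i, hi, h⟩

/-- If there are many parallel lines, one can cover one plane and is left with the others. -/
theorem CoversPlanes.of_card_filter {ι : Type*} {p n : ℕ} [NeZero p]
    {r : ι → ZMod p × ZMod p} {s : Finset ι} {d : ZMod p × ZMod p}
    (hd : p ≤ (s.filter fun i => r i = d).card)
    (ih : ∀ t : Finset ι, t.card + p = s.card → CoversPlanes r t n) :
    CoversPlanes r s (n + 1) := by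
  classical
  obtain ⟨t, hts, ht⟩ := Finset.exists_subset_card_eq hd
  have hts' := hts.trans (Finset.filter_subset _ _)
  refine CoversPlanes.succ hts'
    (coversPlanes_one_of_parallel (fun i hi => (Finset.mem_filter.1 (hts hi)).2) ht) (ih _ ?_)
  have := Finset.card_le_card hts'
  rw [Finset.card_sdiff_of_subset hts']
  omega

/-- Representatives of the directions of lines in the affine plane over `𝔽_2`. -/
def directionsTwo : Finset (ZMod 2 × ZMod 2) := {(1, 0), (0, 1), (1, 1)}

/-- Representatives of the directions of lines in the affine plane over `𝔽_3`. -/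
def directionsThree : Finset (ZMod 3 × ZMod 3) := {(1, 0), (0, 1), (1, 1), (1, 2)}

theorem coversPlanes_two {ι : Type*} (r : ι → ZMod 2 × ZMod 2) (hr : ∀ i, r i ∈ directionsTwo)
    (n : ℕ) (s : Finset ι) (hs : 2 * n + 2 - 1 ≤ s.card) : CoversPlanes r s n := by
  classical
  induction n generalizing s with
  | zero => exact CoversPlanes.zero r s
  | succ n ih =>
    by_cases hd : ∃ d, 2 ≤ (s.filter fun i => r i = d).card
    · obtain ⟨d, hd⟩ := hd
      exact CoversPlanes.of_card_filter hd fun t ht => ih t (by omega)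
    · push Not at hd
      have hsum := Finset.card_eq_sum_card_fiberwise (f := r) (s := s) (t := directionsTwo)
        (fun i _ => hr i)
      simp only [directionsTwo] at hsum
      rw [Finset.sum_insert (by decide), Finset.sum_insert (by decide), Finset.sum_singleton]
        at hsum
      have h1 := hd (1, 0)
      have h2 := hd (0, 1)
      have h3 := hd (1, 1)
      -- With at most one line per direction there are at most three lines, hence a single plane and
      -- exactly one line in each direction.
      obtain rfl : n = 0 := by omega
      refine coversPlanes_one_of_concurrent (D := directionsTwo) (by decide) ?_
      have key : ∀ d, 0 < (s.filter fun i => r i = d).card → ∃ i ∈ s, r i = d := by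
        intro d hd
        obtain ⟨i, hi⟩ := Finset.card_pos.1 hd
        exact ⟨i, Finset.mem_filter.1 hi⟩
      simp only [directionsTwo, Finset.forall_mem_insert, Finset.mem_singleton, forall_eq]
      exact ⟨key _ (by omega), key _ (by omega), key _ (by omega)⟩

/-- Two lines in each of two directions and one line in a third direction cover the affine plane
over `𝔽_3`. -/
theorem coversPlanes_three_of_pairs {ι : Type*} {r : ι → ZMod 3 × ZMod 3} {s : Finset ι}
    {d₁ d₂ d₃ : ZMod 3 × ZMod 3} (hD₁ : d₁ ∈ directionsThree) (hD₂ : d₂ ∈ directionsThree)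
    (h12 : d₁ ≠ d₂) (h13 : d₁ ≠ d₃) (h23 : d₂ ≠ d₃) (h₁ : 2 ≤ (s.filter fun i => r i = d₁).card)
    (h₂ : 2 ≤ (s.filter fun i => r i = d₂).card) (h₃ : 1 ≤ (s.filter fun i => r i = d₃).card) :
    CoversPlanes r s 1 := by
  classical
  obtain ⟨i, hi, i', hi', hii⟩ := Finset.one_lt_card.1 h₁
  obtain ⟨j, hj, j', hj', hjj⟩ := Finset.one_lt_card.1 h₂
  obtain ⟨k, hk⟩ := Finset.card_pos.1 h₃
  rw [Finset.mem_filter] at hi hi' hj hj' hk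
  obtain ⟨his, rfl⟩ := hi
  obtain ⟨hjs, rfl⟩ := hj
  obtain ⟨hks, rfl⟩ := hk
  have hli : ∀ e₁ ∈ directionsThree, ∀ e₂ ∈ directionsThree, e₁ ≠ e₂ → ∀ x y : ZMod 3,
      x * e₁.1 + y * e₁.2 = 0 → x * e₂.1 + y * e₂.2 = 0 → x = 0 ∧ y = 0 := by decide
  have htri : ∀ z : ZMod 3, z = 0 ∨ z = 1 ∨ z = 2 := by decide
  have nij' : i ≠ j' := fun h => h12 (by rw [h, hj'.2])
  have ni'j : i' ≠ j := fun h => h12 (by rw [← hi'.2, h])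
  have ni'j' : i' ≠ j' := fun h => h12 (by rw [← hi'.2, h, hj'.2])
  have ni'k : i' ≠ k := fun h => h13 (by rw [← hi'.2, h])
  have nj'k : j' ≠ k := fun h => h23 (by rw [← hj'.2, h])
  have nij : i ≠ j := fun h => h12 (by rw [h])
  have nik : i ≠ k := fun h => h13 (by rw [h])
  have njk : j ≠ k := fun h => h23 (by rw [h])
  -- The two pairs take the values `1` and `2` of their linear forms. Only the origin is missed, and
  -- the fifth line passes through it.
  refine coversPlanes_one (fun l => if l = i ∨ l = j then 1 else if l = i' ∨ l = j' then 2 else 0)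
    fun x y => ?_
  rcases htri (x * (r i).1 + y * (r i).2) with h | h | h
  · rcases htri (x * (r j).1 + y * (r j).2) with h' | h' | h'
    · obtain ⟨rfl, rfl⟩ := hli _ hD₁ _ hD₂ h12 x y h h'
      exact ⟨k, hks, by simp [nik.symm, njk.symm, ni'k.symm, nj'k.symm]⟩
    · exact ⟨j, hjs, by simp [h']⟩
    · exact ⟨j', hj'.1, by simp [hj'.2, h', nij'.symm, hjj.symm]⟩
  · exact ⟨i, his, by simp [h]⟩
  · exact ⟨i', hi'.1, by simp [hi'.2, h, hii.symm, ni'j]⟩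

theorem coversPlanes_three {ι : Type*} (r : ι → ZMod 3 × ZMod 3)
    (hr : ∀ i, r i ∈ directionsThree) (n : ℕ) (s : Finset ι) (hs : 3 * n + 3 - 1 ≤ s.card) :
    CoversPlanes r s n := by
  classical
  have key : ∀ t : Finset ι, (∀ d ∈ directionsThree, 0 < (t.filter fun i => r i = d).card) →
      CoversPlanes r t 1 := by
    intro t ht
    refine coversPlanes_one_of_concurrent (D := directionsThree) (by decide) fun d hd => ?_
    obtain ⟨i, hi⟩ := Finset.card_pos.1 (ht d hd)
    exact ⟨i, Finset.mem_filter.1 hi⟩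
  induction n generalizing s with
  | zero => exact CoversPlanes.zero r s
  | succ n ih =>
    by_cases hd : ∃ d, 3 ≤ (s.filter fun i => r i = d).card
    · obtain ⟨d, hd⟩ := hd
      exact CoversPlanes.of_card_filter hd fun t ht => ih t (by omega)
    · push Not at hd
      have hsum := Finset.card_eq_sum_card_fiberwise (f := r) (s := s) (t := directionsThree)
        (fun i _ => hr i)
      simp only [directionsThree] at hsum
      rw [Finset.sum_insert (by decide), Finset.sum_insert (by decide),
        Finset.sum_insert (by decide), Finset.sum_singleton] at hsum
      have h1 := hd (1, 0)
      have h2 := hd (0, 1)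
      have h3 := hd (1, 1)
      have h4 := hd (1, 2)
      -- At most two lines per direction means at most eight lines, hence at most two planes. One
      -- plane is covered by a full pencil or, if a direction is absent, by a `2 + 2 + 1`
      -- configuration; for two planes each direction occurs exactly twice, which gives two pencils.
      obtain rfl | rfl : n = 0 ∨ n = 1 := by omega
      · have m1 : ((1, 0) : ZMod 3 × ZMod 3) ∈ directionsThree := by decide
        have m2 : ((0, 1) : ZMod 3 × ZMod 3) ∈ directionsThree := by decide
        have m3 : ((1, 1) : ZMod 3 × ZMod 3) ∈ directionsThree := by decide
        have m4 : ((1, 2) : ZMod 3 × ZMod 3) ∈ directionsThree := by decide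
        by_cases hpos : ∀ d ∈ directionsThree, 1 ≤ (s.filter fun i => r i = d).card
        · exact key s hpos
        push Not at hpos
        obtain ⟨d, hdD, hd0⟩ := hpos
        have hpairs := @coversPlanes_three_of_pairs ι r s
        simp only [directionsThree, Finset.mem_insert, Finset.mem_singleton] at hdD
        have hcases : ∀ a b c : ℕ, a < 3 → b < 3 → c < 3 → 5 ≤ a + b + c →
            (2 ≤ a ∧ 2 ≤ b ∧ 1 ≤ c) ∨ (2 ≤ a ∧ 2 ≤ c ∧ 1 ≤ b) ∨ (2 ≤ b ∧ 2 ≤ c ∧ 1 ≤ a) := by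
          omega
        have hthree : ∀ e₁ ∈ directionsThree, ∀ e₂ ∈ directionsThree, ∀ e₃ ∈ directionsThree,
            e₁ ≠ e₂ → e₁ ≠ e₃ → e₂ ≠ e₃ →
            5 ≤ (s.filter fun i => r i = e₁).card + (s.filter fun i => r i = e₂).card +
              (s.filter fun i => r i = e₃).card → CoversPlanes r s 1 := by
          intro e₁ m₁ e₂ m₂ e₃ m₃ h12 h13 h23 h5
          rcases hcases _ _ _ (hd e₁) (hd e₂) (hd e₃) h5 with ⟨f, g, h⟩ | ⟨f, g, h⟩ | ⟨f, g, h⟩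
          · exact hpairs m₁ m₂ h12 h13 h23 f g h
          · exact hpairs m₁ m₃ h13 h12 h23.symm f g h
          · exact hpairs m₂ m₃ h23 h12.symm h13.symm f g h
        rcases hdD with rfl | rfl | rfl | rfl
        · exact hthree _ m2 _ m3 _ m4 (by decide) (by decide) (by decide) (by omega)
        · exact hthree _ m1 _ m3 _ m4 (by decide) (by decide) (by decide) (by omega)
        · exact hthree _ m1 _ m2 _ m4 (by decide) (by decide) (by decide) (by omega)
        · exact hthree _ m1 _ m2 _ m3 (by decide) (by decide) (by decide) (by omega)
      · have hpos : ∀ d ∈ directionsThree, 2 ≤ (s.filter fun i => r i = d).card := by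
          simp only [directionsThree, Finset.forall_mem_insert, Finset.mem_singleton, forall_eq]
          exact ⟨by omega, by omega, by omega, by omega⟩
        have : Nonempty ι := (Finset.card_pos.1 (by omega : 0 < s.card)).to_type
        choose! f hf using fun d hd => Finset.card_pos.1 (lt_of_lt_of_le two_pos (hpos d hd))
        have hfd : ∀ d ∈ directionsThree, f d ∈ s ∧ r (f d) = d := fun d hd =>
          Finset.mem_filter.1 (hf d hd)
        have hsub : directionsThree.image f ⊆ s := by
          intro i hi
          obtain ⟨d, hd, rfl⟩ := Finset.mem_image.1 hi
          exact (hfd d hd).1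
        refine CoversPlanes.succ hsub (key _ fun d hd => ?_) (key _ fun d hd => ?_)
        · exact Finset.card_pos.2
            ⟨f d, Finset.mem_filter.2 ⟨Finset.mem_image_of_mem f hd, (hfd d hd).2⟩⟩
        · obtain ⟨i, hi, hne⟩ := Finset.exists_mem_ne (hpos d hd) (f d)
          obtain ⟨his, hid⟩ := Finset.mem_filter.1 hi
          refine Finset.card_pos.2 ⟨i, Finset.mem_filter.2 ⟨Finset.mem_sdiff.2 ⟨his, ?_⟩, hid⟩⟩
          intro himg
          obtain ⟨e, he, rfl⟩ := Finset.mem_image.1 himg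
          rw [(hfd e he).2] at hid
          exact hne (by rw [hid])

/-! ### The characters of `C_p ⊕ C_{pn}` as the points of `n` affine planes. -/

section PlaneChar

variable {K : Type*} [Field K] {p n : ℕ} [NeZero p] [NeZero n] {ζ : K}

/-- The character `(u, v) ↦ ζ ^ (τ * v) * (ζ ^ n) ^ (x * u + y * v)` of `C_p ⊕ C_{pn}`, for a
primitive `p * n`-th root of unity `ζ`. -/
noncomputable def planeChar (hζ : IsPrimitiveRoot ζ (p * n)) (τ : ℕ) (x y : ZMod p) :
    AddChar (ZMod p × ZMod (p * n)) K where
  toFun g := AddChar.zmodChar (p * n) hζ.pow_eq_one g.2 ^ τ *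
    AddChar.zmodChar p (ζ := ζ ^ n) (by rw [← pow_mul, mul_comm, hζ.pow_eq_one])
      (x * (reduceMod p n g).1 + y * (reduceMod p n g).2)
  map_zero_eq_one' := by simp
  map_add_eq_mul' g h := by
    simp only [map_add, Prod.fst_add, Prod.snd_add, AddChar.map_add_eq_mul, mul_add, mul_pow]
    ring

variable (hζ : IsPrimitiveRoot ζ (p * n))

theorem planeChar_apply (τ : ℕ) (x y : ZMod p) (g : ZMod p × ZMod (p * n)) :
    planeChar hζ τ x y g = ζ ^ (g.2.val * τ) *
      (ζ ^ n) ^ (x * (reduceMod p n g).1 + y * (reduceMod p n g).2).val := by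
  rw [pow_mul]
  rfl

theorem planeChar_zero : planeChar hζ 0 0 0 = 1 := by
  ext g
  simp [planeChar_apply]

theorem planeChar_add (τ τ' : ℕ) (x x' y y' : ZMod p) :
    planeChar hζ (τ + τ') (x + x') (y + y') = planeChar hζ τ x y * planeChar hζ τ' x' y' := by
  ext g
  rw [AddChar.mul_apply]
  simp only [planeChar, AddChar.coe_mk]
  rw [show (x + x') * (reduceMod p n g).1 + (y + y') * (reduceMod p n g).2 =
    (x * (reduceMod p n g).1 + y * (reduceMod p n g).2) +
    (x' * (reduceMod p n g).1 + y' * (reduceMod p n g).2) by ring, AddChar.map_add_eq_mul, pow_add]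
  ring

theorem pow_val_eq_iff {k : ℕ} [NeZero k] {ω : K} (hω : IsPrimitiveRoot ω k) {a b : ZMod k} :
    ω ^ a.val = ω ^ b.val ↔ a = b :=
  ⟨fun h => ZMod.val_injective k (hω.pow_inj a.val_lt b.val_lt h), fun h => by rw [h]⟩

theorem isPrimitiveRoot_pow_right (hζ : IsPrimitiveRoot ζ (p * n)) :
    IsPrimitiveRoot (ζ ^ n) p :=
  hζ.pow (NeZero.pos _) (mul_comm p n)

theorem planeChar_separates (g h : ZMod p × ZMod (p * n))
    (hgh : ∀ τ x y, planeChar hζ τ x y g = planeChar hζ τ x y h) : g = h := by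
  have h1 := hgh 1 0 0
  have h2 := hgh 0 1 0
  simp only [planeChar_apply, mul_one, zero_mul, add_zero, ZMod.val_zero, pow_zero, mul_zero,
    one_mul] at h1 h2
  rw [pow_val_eq_iff hζ] at h1
  rw [pow_val_eq_iff (isPrimitiveRoot_pow_right hζ)] at h2
  exact Prod.ext h2 h1

/-- Raising `τ` by `n` multiplies by a character of order `p`, which is a translation inside the
plane. Hence the planes `τ < n` already contain all these characters. -/
theorem planeChar_add_mul (τ k : ℕ) (x y : ZMod p) :
    planeChar hζ (τ + n * k) x y = planeChar hζ τ x (y + k) := by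
  have : planeChar hζ (n * k) 0 0 = planeChar hζ 0 0 k := by
    ext g
    simp only [planeChar_apply, zero_mul, add_zero, zero_add, ZMod.val_zero, pow_zero, mul_one,
      mul_zero, one_mul]
    have h2 : (reduceMod p n g).2 = ((g.2.val : ℕ) : ZMod p) := by
      change ZMod.castHom (Dvd.intro n rfl) (ZMod p) g.2 = _
      rw [ZMod.castHom_apply, ZMod.natCast_val]
    rw [h2, ← Nat.cast_mul, ZMod.val_natCast, ← pow_eq_pow_mod _
      (isPrimitiveRoot_pow_right hζ).pow_eq_one, ← pow_mul]
    congr 1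
    ring
  have h1 := planeChar_add hζ τ (n * k) x 0 y 0
  have h2 := planeChar_add hζ τ 0 x 0 y k
  rw [this, ← h2] at h1
  simpa using h1

/-- An element of the group algebra that vanishes at all characters is zero. -/
theorem eq_zero_of_forall_planeChar (f : AddMonoidAlgebra K (ZMod p × ZMod (p * n)))
    (hf : ∀ τ < n, ∀ x y, AddMonoidAlgebra.lift K K _ (planeChar hζ τ x y).toMonoidHom f = 0) :
    f = 0 := by
  refine eq_zero_of_forall_lift_eq_zero
    (fun m : ℕ × ZMod p × ZMod p => planeChar hζ m.1 m.2.1 m.2.2) (planeChar_zero hζ)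
    (fun m m' => planeChar_add hζ _ _ _ _ _ _)
    (fun g h hgh => planeChar_separates hζ g h fun τ x y => hgh (τ, x, y)) f ?_
  rintro ⟨τ, x, y⟩
  have h := hf (τ % n) (Nat.mod_lt _ (NeZero.pos n)) x (y + (τ / n : ℕ))
  rwa [← planeChar_add_mul, Nat.mod_add_div] at h

/-- If lines in the directions of `g i` can cover `n` planes, then a suitable product of factors
`X ^ (g i) - a i` vanishes. -/
theorem exists_prod_groupAlgebraFactor_eq_zero (hζ : IsPrimitiveRoot ζ (p * n)) {ι : Type*}
    [Fintype ι]
    (g : ι → ZMod p × ZMod (p * n)) (r : ι → ZMod p × ZMod p) (c : ι → ZMod p)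
    (hr : ∀ i, reduceMod p n (g i) = (c i * (r i).1, c i * (r i).2))
    (h : CoversPlanes r Finset.univ n) :
    ∃ a : ι → K, (∀ i, a i ≠ 0) ∧ ∏ i, groupAlgebraFactor (g i) (a i) = 0 := by
  obtain ⟨T, b, hT⟩ := h
  have hζ0 : ζ ≠ 0 := hζ.ne_zero (NeZero.ne _)
  -- `a i` is the value at `g i` of the characters on the chosen line of the plane `T i`; if `c i =
  -- 0`, the factor vanishes on that whole plane.
  refine ⟨fun i => ζ ^ ((g i).2.val * T i) * (ζ ^ n) ^ (c i * b i).val,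
    fun i => mul_ne_zero (pow_ne_zero _ hζ0) (pow_ne_zero _ (pow_ne_zero _ hζ0)), ?_⟩
  refine eq_zero_of_forall_planeChar hζ _ fun τ hτ x y => ?_
  rw [lift_prod_groupAlgebraFactor]
  obtain ⟨i, hi, rfl, hb⟩ := hT τ hτ x y
  refine Finset.prod_eq_zero hi ?_
  rw [planeChar_apply, sub_eq_zero, hr i, ← hb]
  congr 3
  ring

/-- The pairs `(τ, z)` at which `ζ ^ τ * (ζ ^ n) ^ z` takes one of the values `a i`. -/
theorem sum_card_filter_le [DecidableEq K] (hζ : IsPrimitiveRoot ζ (p * n)) {ι : Type*} [Fintype ι]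
    (a : ι → K) (φ : ZMod p → ZMod p) (hφ : Function.Injective φ) :
    ∑ τ ∈ Finset.range n, (Finset.univ.filter fun z : ZMod p =>
      ∃ i, ζ ^ τ * (ζ ^ n) ^ (φ z).val = a i).card ≤ Fintype.card ι := by
  rw [← Finset.card_sigma]
  refine (Finset.card_le_card_of_injOn (t := Finset.univ.image a)
    (fun s => ζ ^ s.1 * (ζ ^ n) ^ (φ s.2).val) ?_ ?_).trans Finset.card_image_le
  · rintro ⟨τ, z⟩ hs
    obtain ⟨-, hz⟩ := Finset.mem_sigma.1 hs
    obtain ⟨i, hi⟩ := (Finset.mem_filter.1 hz).2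
    exact Finset.mem_image.2 ⟨i, Finset.mem_univ _, hi.symm⟩
  · rintro ⟨τ, z⟩ hs ⟨τ', z'⟩ hs' h
    have hτ := Finset.mem_range.1 (Finset.mem_sigma.1 hs).1
    have hτ' := Finset.mem_range.1 (Finset.mem_sigma.1 hs').1
    simp only [← pow_mul, ← pow_add] at h hτ hτ'
    -- The exponents `τ + n * z` with `τ < n`, `z < p` are distinct and below `p * n`, so each `a i`
    -- accounts for at most one pair.
    have hlt : ∀ (σ : ℕ) (w : ZMod p), σ < n → σ + n * w.val < p * n := by
      intro σ w hσ
      have h1 : n * (w.val + 1) ≤ n * p := Nat.mul_le_mul_left _ w.val_lt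
      rw [mul_comm p n]
      linarith
    have heq := hζ.pow_inj (hlt τ _ hτ) (hlt τ' _ hτ') h
    have hm := congrArg (· % n) heq
    have hd := congrArg (· / n) heq
    simp only [Nat.add_mul_mod_self_left, Nat.mod_eq_of_lt hτ, Nat.mod_eq_of_lt hτ'] at hm
    simp only [Nat.add_mul_div_left _ _ (NeZero.pos n), Nat.div_eq_of_lt hτ,
      Nat.div_eq_of_lt hτ', zero_add] at hd
    rw [hm, hφ (ZMod.val_injective p hd)]

end PlaneChar

/-! ### The two bounds for `d(G, K)` and the conclusion. -/

theorem smallDavenport_le {p n : ℕ} [Fact p.Prime] [NeZero n] :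
    smallDavenport (ZMod p × ZMod (p * n)) ≤ (p + p * n - 2 : ℕ) := by
  refine sSup_le ?_
  rintro m ⟨l, rfl, g, hg⟩
  by_contra hl
  have hp := (Fact.out : p.Prime).two_le
  have hl' : p + p * n - 2 < l := by
    rw [not_le] at hl
    exact_mod_cast hl
  obtain ⟨t, -, ht, h0⟩ := exists_sum_eq_zero_of_rank_two (NeZero.ne n) Finset.univ g (by
    rw [Finset.card_univ, Fintype.card_fin]
    omega)
  exact hg t ht h0

/-- `D` represents the directions of `𝔽_p ^ 2`. An element reducing to `0` may be given any
direction, with scalar `0`. -/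
theorem algebraDavenport_le {K : Type*} [Field K] {p n : ℕ} [NeZero p] [NeZero n] {ζ : K}
    (hζ : IsPrimitiveRoot ζ (p * n)) (D : Finset (ZMod p × ZMod p))
    (hD : ∀ v : ZMod p × ZMod p, ∃ d ∈ D, ∃ c : ZMod p, v = (c * d.1, c * d.2))
    (hcov : ∀ {l : ℕ} (r : Fin l → ZMod p × ZMod p), (∀ i, r i ∈ D) →
      ∀ s : Finset (Fin l), p * n + p - 1 ≤ s.card → CoversPlanes r s n) :
    algebraDavenport (ZMod p × ZMod (p * n)) K ≤ (p + p * n - 2 : ℕ) := by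
  refine sSup_le ?_
  rintro m ⟨l, rfl, g, hg⟩
  by_contra hl
  have hl' : p + p * n - 2 < l := by
    rw [not_le] at hl
    exact_mod_cast hl
  choose r hr c hc using fun i => hD (reduceMod p n (g i))
  obtain ⟨a, ha, h0⟩ := exists_prod_groupAlgebraFactor_eq_zero hζ g r c hc
    (hcov r hr Finset.univ (by
      rw [Finset.card_univ, Fintype.card_fin]
      omega))
  exact hg a ha h0

/-- The sequence `(1, 1)^{p(n-1)-1} (-1, 1)^{p-1} (0, 1)^{p-1} (2, 1)^2` over `C_p ⊕ C_{pn}`. -/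
def fourDirections (p n : ℕ) :
    (Fin (p * (n - 1) - 1) ⊕ Fin (p - 1)) ⊕ (Fin (p - 1) ⊕ Fin 2) → ZMod p × ZMod (p * n) :=
  Sum.elim (Sum.elim (fun _ => (1, 1)) (fun _ => (-1, 1)))
    (Sum.elim (fun _ => (0, 1)) (fun _ => (2, 1)))

theorem exists_planeChar_fourDirections_ne {K : Type*} [Field K] {p n : ℕ} [Fact p.Prime] [NeZero n]
    {ζ : K} (hζ : IsPrimitiveRoot ζ (p * n)) (hp : 5 ≤ p) (hn : 2 ≤ n)
    (a : (Fin (p * (n - 1) - 1) ⊕ Fin (p - 1)) ⊕ (Fin (p - 1) ⊕ Fin 2) → K) :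
    ∃ τ x y, ∀ i, planeChar hζ τ x y (fourDirections p n i) ≠ a i := by
  classical
  have h2 : (2 : ZMod p) ≠ 0 := by
    exact_mod_cast ZMod.natCast_ne_zero_of_lt (p := p) (c := 2) (by omega) (by omega)
  have hhalf : Function.Injective fun z : ZMod p => z / 2 := fun z z' h =>
    (div_left_inj' h2).1 h
  have hpn : p * n ≠ 1 := by
    have : p * 1 ≤ p * n := Nat.mul_le_mul_left _ (by omega)
    omega
  obtain ⟨τ, -, hτ⟩ := exists_not_linesCover hp hn _ _ _ _
    ((sum_card_filter_le hζ (fun i => a (.inl (.inl i))) id Function.injective_id).trans_eq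
      (Fintype.card_fin _))
    ((sum_card_filter_le hζ (fun i => a (.inl (.inr i))) id Function.injective_id).trans_eq
      (Fintype.card_fin _))
    ((sum_card_filter_le hζ (fun i => a (.inr (.inl i))) _ hhalf).trans_eq (Fintype.card_fin _))
    ((sum_card_filter_le hζ (fun i => a (.inr (.inr i))) _ hhalf).trans_eq (Fintype.card_fin _))
  simp only [LinesCover, Finset.mem_filter, Finset.mem_univ, true_and, not_forall, not_or,
    not_exists, id] at hτ
  obtain ⟨x, y, hA, hB, hC, hD⟩ := hτ
  -- In these coordinates the linear forms attached to `(1, 1)`, `(-1, 1)`, `(0, 1)`, `(2, 1)`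
  -- become `x`, `y`, `(x + y) / 2`, `(3 * x - y) / 2`, the directions of `LinesCover` up to the
  -- halving `hhalf`.
  have hval : ∀ u : ZMod p, planeChar hζ τ ((x - y) / 2) ((x + y) / 2) (u, 1) =
      ζ ^ τ * (ζ ^ n) ^ ((x - y) / 2 * u + (x + y) / 2).val := by
    intro u
    have hred : reduceMod p n (u, 1) = (u, 1) := Prod.ext rfl 
      (map_one (ZMod.castHom (Dvd.intro n rfl) (ZMod p)))
    rw [planeChar_apply, hred, ZMod.val_one'' hpn, one_mul, mul_one]
  refine ⟨τ, (x - y) / 2, (x + y) / 2, ?_⟩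
  rintro ((i | i) | (i | i)) h
  · refine hA i ?_
    rw [← h, fourDirections, Sum.elim_inl, Sum.elim_inl, hval]
    congr 3
    field_simp
    ring
  · refine hB i ?_
    rw [← h, fourDirections, Sum.elim_inl, Sum.elim_inr, hval]
    congr 3
    field_simp
    ring
  · refine hC i ?_
    rw [← h, fourDirections, Sum.elim_inr, Sum.elim_inl, hval]
    congr 3
    ring
  · refine hD i ?_
    rw [← h, fourDirections, Sum.elim_inr, Sum.elim_inr, hval]
    congr 3
    field_simp
    ring

theorem le_algebraDavenport {K : Type*} [Field K] {p n : ℕ} [Fact p.Prime] [NeZero n]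
    {ζ : K} (hζ : IsPrimitiveRoot ζ (p * n)) (hp : 5 ≤ p) (hn : 2 ≤ n) :
    ((p + p * n - 1 : ℕ) : ℕ∞) ≤ algebraDavenport (ZMod p × ZMod (p * n)) K := by
  have e : Fin (p + p * n - 1) ≃ (Fin (p * (n - 1) - 1) ⊕ Fin (p - 1)) ⊕ (Fin (p - 1) ⊕ Fin 2) := by
    refine Fintype.equivOfCardEq ?_
    simp only [Fintype.card_fin, Fintype.card_sum]
    obtain ⟨m, rfl⟩ : ∃ m, n = m + 2 := ⟨n - 2, by omega⟩
    have h1 : p * (m + 2 - 1) = p * m + p := by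
      rw [show m + 2 - 1 = m + 1 by omega]; ring
    have h2 : p * (m + 2) = p * m + 2 * p := by ring
    omega
  refine le_sSup ⟨_, rfl, fun i => fourDirections p n (e i), fun a _ h => ?_⟩
  obtain ⟨τ, x, y, hne⟩ := exists_planeChar_fourDirections_ne hζ hp hn (fun j => a (e.symm j))
  have h0 := lift_prod_groupAlgebraFactor Finset.univ (planeChar hζ τ x y)
    (fun i => fourDirections p n (e i)) a
  rw [h, map_zero] at h0
  obtain ⟨i, -, hi⟩ := Finset.prod_eq_zero_iff.1 h0.symm
  apply hne (e i)
  rw [e.symm_apply_apply]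
  exact sub_eq_zero.1 hi

theorem theorem1p1 {G K : Type*} [AddCommGroup G] [Field K] (p n : ℕ) (hp : p.Prime) (hn : 1 ≤ n)
    (hG : Nonempty (G ≃+ ZMod p × ZMod (p * n))) (hK : IsSplittingFieldOfGroup G K) :
    (p ≤ 3 → smallDavenport G = algebraDavenport G K) ∧
    (5 ≤ p → 2 ≤ n → smallDavenport G < algebraDavenport G K) := by
  obtain ⟨e⟩ := hG
  have : Fact p.Prime := ⟨hp⟩
  have : NeZero n := ⟨by omega⟩
  have hexp : AddMonoid.exponent G = p * n :=
    (AddMonoid.exponent_eq_of_addEquiv e).trans (exponent_zmod_prod p n)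
  rw [IsSplittingFieldOfGroup, hexp] at hK
  obtain ⟨ζ, hζ⟩ := exists_isPrimitiveRoot_of_card hK
  refine ⟨fun hp3 => (smallDavenport_le_algebraDavenport G K).antisymm ?_, fun hp5 hn2 => ?_⟩
  · rw [smallDavenport_congr e, algebraDavenport_congr e]
    refine le_trans ?_ (le_smallDavenport_prod hp.pos (Nat.mul_pos hp.pos hn))
    have hp2 := hp.two_le
    obtain rfl | rfl : p = 2 ∨ p = 3 := by omega
    · exact algebraDavenport_le hζ directionsTwo (by decide) fun r hr s hs =>
        coversPlanes_two r hr n s hs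
    · exact algebraDavenport_le hζ directionsThree (by decide) fun r hr s hs =>
        coversPlanes_three r hr n s hs
  · rw [smallDavenport_congr e, algebraDavenport_congr e]
    refine smallDavenport_le.trans_lt (lt_of_lt_of_le ?_ (le_algebraDavenport hζ hp5 hn2))
    exact_mod_cast (by omega : p + p * n - 2 < p + p * n - 1)
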